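/- There are constants $c>0$, $C$ and $N$ such that for every $n\ge N$ there are a simple graph $G$ with $n$ vertices and at most $Cn^2$ edges and a straight-line drawing $D$ of $G$ in the plane such that every casing of $D$ has at least $cn^4$ switches. Here the vertices of a straight-line drawing are distinct points, each edge is the segment joining its endpoints, no vertex lies on an edge of which it is not an endpoint, and no three edges cross in one point, where two edges cross if they share a point that is interior to both. A casing of $D$ chooses, for each crossing independently, which of the two edges is on top; the crossing is a bridge for the upper edge and a tunnel for the lower one. A switch is an (unordered) pair of consecutive crossings along an edge $e$ one of which is a bridge for $e$ and the other a tunnel for $e$; the switches along all edges are counted. -/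

import Mathlib

/-- A straight-line drawing of the graph `G` in the plane. Vertices are distinct points, each edge is
the segment between its endpoints, no vertex lies on an edge unless it is an endpoint of that
edge, and no three edges cross in one point (edges meeting at a common endpoint do not cross there). -/
structure StraightLineDrawing {V : Type*} (G : SimpleGraph V) where
  /-- The position of a vertex. -/
  pos : V → ℝ × ℝ
  pos_injective : Function.Injective pos
  vertex_not_on_edge : ∀ u v w : V, G.Adj u v → w ≠ u → w ≠ v →
    pos w ∉ segment ℝ (pos u) (pos v)
  no_triple_crossing : ∀ (e f g : G.edgeSet) (p : ℝ × ℝ), e ≠ f → f ≠ g → e ≠ g →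
    ¬ ((∃ u v, (e : Sym2 V) = s(u, v) ∧ p ∈ openSegment ℝ (pos u) (pos v)) ∧
       (∃ u v, (f : Sym2 V) = s(u, v) ∧ p ∈ openSegment ℝ (pos u) (pos v)) ∧
       (∃ u v, (g : Sym2 V) = s(u, v) ∧ p ∈ openSegment ℝ (pos u) (pos v)))

namespace StraightLineDrawing

/-- The points of the drawn edge `e` other than its two endpoints. -/
def edgeInterior {V : Type*} {G : SimpleGraph V} (D : StraightLineDrawing G) (e : G.edgeSet) :
    Set (ℝ × ℝ) :=
  {p | ∃ u v, (e : Sym2 V) = s(u, v) ∧ p ∈ openSegment ℝ (D.pos u) (D.pos v)}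

/-- The two edges `e` and `f` cross at the point `p`. -/
def CrossAt {V : Type*} {G : SimpleGraph V} (D : StraightLineDrawing G) (e f : G.edgeSet)
    (p : ℝ × ℝ) : Prop :=
  e ≠ f ∧ p ∈ D.edgeInterior e ∧ p ∈ D.edgeInterior f

/-- The two edges `e` and `f` cross. -/
def Cross {V : Type*} {G : SimpleGraph V} (D : StraightLineDrawing G) (e f : G.edgeSet) : Prop :=
  ∃ p, D.CrossAt e f p

/-- A casing of a drawing in the weaving model: at every crossing, independently of all the others,
exactly one of the two edges is on top. The value of `onTop` at pairs of edges that do not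
cross is irrelevant. -/
structure Casing {V : Type*} {G : SimpleGraph V} (D : StraightLineDrawing G) where
  /-- `onTop e f`: the edge `e` is drawn on top of the edge `f` at their crossing. -/
  onTop : G.edgeSet → G.edgeSet → Prop
  onTop_iff_not : ∀ e f, D.Cross e f → (onTop e f ↔ ¬ onTop f e)

/-- The crossings of `e` with `f` and of `e` with `g` are consecutive along the edge `e`: they are
different points of `e` and no edge crosses `e` strictly between them. -/
def Consecutive {V : Type*} {G : SimpleGraph V} (D : StraightLineDrawing G)
    (e f g : G.edgeSet) : Prop :=
  ∃ p q, p ≠ q ∧ D.CrossAt e f p ∧ D.CrossAt e g q ∧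
    ∀ h r, D.CrossAt e h r → r ∉ openSegment ℝ p q

/-- The switches of a casing: pairs of consecutive crossings along an edge `e` one of which, the one
with `f`, is a bridge for `e`, and the other, the one with `g`, is a tunnel for `e`. As
the bridge is listed first, each unordered pair of crossings that is a switch along `e` occurs
exactly once. -/
def Casing.switches {V : Type*} {G : SimpleGraph V} {D : StraightLineDrawing G} (κ : D.Casing) :
    Set (G.edgeSet × G.edgeSet × G.edgeSet) :=
  {t | D.Consecutive t.1 t.2.1 t.2.2 ∧ κ.onTop t.1 t.2.1 ∧ κ.onTop t.2.2 t.1}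

end StraightLineDrawing

/-! The graph is `K_{k,k}` with its two sides on two horizontal lines, so that edges are points `(i,
j)` of a `k × k` grid. A point of the strip between the lines lies on exactly those edges whose
points `(i, height k j)` lie on a certain oblique line. With exactly equidistant vertices, the edges
of three grid points `P`, `P + (a, b)`, `P + 2(a, b)` with `a, b > 0` would be concurrent. The
perturbation in `height` makes no three edges concurrent (`not_height_collinear`), yet is too small
to mix different grid lines.

However the three pairwise crossings of such a triple are cased, one of its edges is above one of
the others and below the third (`Casing.exists_onTop_onTop`). A switch therefore occurs on that edge
between the two crossings (`Casing.exists_switch_between`). The bridge of this switch lies so close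
to the old concurrency point that the edge crossed there belongs to the same grid line
(`weavingLine.collinear_of_nearDirection`).

Hence the two edges at the bridge determine the primitive direction `(a, b)`. As `P.1 < a`, the
position of the edge in its triple and then `P` are determined too, and different triples give
different switches. There are of order `r ^ 2` primitive directions and `r ^ 2` base points, with `k
= 24 * r` and `r = n / 48`. -/

namespace StraightLineDrawing

/-! ### Switches forced by a casing -/

/-- If `e` is on top of `f` and below `g`, then a switch occurs along `e` between the two
crossings. -/
theorem Casing.exists_switch_between {V : Type*} [Finite V] {G : SimpleGraph V}
    {D : StraightLineDrawing G} (κ : D.Casing) {e f g : G.edgeSet} {p q : ℝ × ℝ}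
    (huniq : ∀ h r s, D.CrossAt e h r → D.CrossAt e h s → r = s)
    (hp : D.CrossAt e f p) (hq : D.CrossAt e g q) (hf : κ.onTop e f) (hg : κ.onTop g e) :
    ∃ f' g' p', (e, f', g') ∈ κ.switches ∧ D.CrossAt e f' p' ∧ p' ∈ segment ℝ p q := by
  let C : Set (ℝ × ℝ) := {r | ∃ h, D.CrossAt e h r}
  have hC : C.Finite := by
    have : C = ⋃ h, {r | D.CrossAt e h r} := by ext; simp [C]
    rw [this]
    exact Set.finite_iUnion fun h => Set.Subsingleton.finite fun r hr s hs => huniq h r s hr hs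
  let S : Set ((ℝ × ℝ) × (ℝ × ℝ)) := {w | w.1 ∈ segment ℝ p q ∧ w.2 ∈ segment ℝ p q ∧
    (∃ h, D.CrossAt e h w.1 ∧ κ.onTop e h) ∧ ∃ h, D.CrossAt e h w.2 ∧ κ.onTop h e}
  have hS : S.Finite := (hC.prod hC).subset fun w hw =>
    ⟨⟨_, hw.2.2.1.choose_spec.1⟩, ⟨_, hw.2.2.2.choose_spec.1⟩⟩
  have hne : S.Nonempty := ⟨(p, q), left_mem_segment ℝ p q, right_mem_segment ℝ p q,
    ⟨f, hp, hf⟩, ⟨g, hq, hg⟩⟩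
  -- A closest pair of a bridge and a tunnel has no crossing in between: whether that crossing is a
  -- bridge or a tunnel, it would form a closer pair with one of the two.
  obtain ⟨⟨p', q'⟩, ⟨hp', hq', ⟨f', hf', hef⟩, ⟨g', hg', hge⟩⟩, hmin⟩ :=
    Set.exists_min_image S (fun w => dist w.1 w.2) hS hne
  dsimp only at hp' hq' hf' hg'
  refine ⟨f', g', p', ⟨⟨p', q', ?_, hf', hg', ?_⟩, hef, hge⟩, hf', hp'⟩
  · rintro rfl
    have hfg : f' ≠ g' := by
      rintro rfl
      exact (κ.onTop_iff_not e f' ⟨_, hf'⟩).1 hef hge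
    exact D.no_triple_crossing e f' g' p' hf'.1 hfg hg'.1 ⟨hf'.2.1, hf'.2.2, hg'.2.2⟩
  · intro h r hr hmem
    have hne' : p' ≠ q' := by
      rintro rfl
      have hfg : f' ≠ g' := by
        rintro rfl
        exact (κ.onTop_iff_not e f' ⟨_, hf'⟩).1 hef hge
      exact D.no_triple_crossing e f' g' p' hf'.1 hfg hg'.1 ⟨hf'.2.1, hf'.2.2, hg'.2.2⟩
    have hseg : r ∈ segment ℝ p q :=
      (convex_segment p q).segment_subset hp' hq' (openSegment_subset_segment ℝ p' q' hmem)
    have hdist := dist_add_dist_of_mem_segment (openSegment_subset_segment ℝ p' q' hmem)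
    have hpr : p' ≠ r := by
      rintro rfl
      exact hne' (left_mem_openSegment_iff.1 hmem)
    have hrq : r ≠ q' := by
      rintro rfl
      exact hne' (right_mem_openSegment_iff.1 hmem)
    by_cases ht : κ.onTop e h
    · have := hmin (r, q') ⟨hseg, hq', ⟨h, hr, ht⟩, ⟨g', hg', hge⟩⟩
      have := dist_pos.2 hpr
      dsimp only at *
      linarith
    · have hc : D.Cross h e := ⟨r, hr.1.symm, hr.2.2, hr.2.1⟩
      have := hmin (p', r) ⟨hp', hseg, ⟨f', hf', hef⟩, ⟨h, hr, (κ.onTop_iff_not h e hc).2 ht⟩⟩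
      have := dist_pos.2 hrq
      dsimp only at *
      linarith

/-- Among three pairwise crossing edges, one is on top of another and below the third. -/
theorem Casing.exists_onTop_onTop {V : Type*} {G : SimpleGraph V}
    {D : StraightLineDrawing G} (κ : D.Casing) (e : Fin 3 → G.edgeSet)
    (h : ∀ a b, a ≠ b → D.Cross (e a) (e b)) :
    ∃ a b c, a ≠ b ∧ a ≠ c ∧ κ.onTop (e a) (e b) ∧ κ.onTop (e c) (e a) := by
  have h01 := κ.onTop_iff_not _ _ (h 0 1 (by decide))
  have h02 := κ.onTop_iff_not _ _ (h 0 2 (by decide))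
  have h12 := κ.onTop_iff_not _ _ (h 1 2 (by decide))
  by_cases a : κ.onTop (e 0) (e 1)
  · by_cases b : κ.onTop (e 1) (e 2)
    · exact ⟨1, 2, 0, by decide, by decide, b, a⟩
    · have b' : κ.onTop (e 2) (e 1) := by tauto
      by_cases c : κ.onTop (e 0) (e 2)
      · exact ⟨2, 1, 0, by decide, by decide, b', c⟩
      · exact ⟨0, 1, 2, by decide, by decide, a, by tauto⟩
  · have a' : κ.onTop (e 1) (e 0) := by tauto
    by_cases b : κ.onTop (e 0) (e 2)
    · exact ⟨0, 2, 1, by decide, by decide, b, a'⟩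
    · have b' : κ.onTop (e 2) (e 0) := by tauto
      by_cases c : κ.onTop (e 1) (e 2)
      · exact ⟨2, 0, 1, by decide, by decide, b', c⟩
      · exact ⟨1, 0, 2, by decide, by decide, a', by tauto⟩

end StraightLineDrawing

/-! ### Density of coprime pairs -/

theorem sum_one_div_sq_Icc_two_le (m : ℕ) :
    ∑ d ∈ Finset.Icc 2 m, (1 / (d : ℝ)) ^ 2 ≤ 3 / 4 := by
  -- The sharper bound telescopes, with equality at `s = 2`.
  have key : ∀ s : ℕ, 2 ≤ s → ∑ d ∈ Finset.Icc 2 s, (1 / (d : ℝ)) ^ 2 ≤ (3 / 4 - 1 / s : ℝ) := by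
    intro s hs
    induction s, hs using Nat.le_induction with
    | base => norm_num
    | succ s hs ih =>
      rw [Finset.sum_Icc_succ_top (by omega)]
      have hs0 : (0 : ℝ) < s := by positivity
      have : (1 / ((s + 1 : ℕ) : ℝ)) ^ 2 ≤ 1 / s - 1 / ((s + 1 : ℕ) : ℝ) := by
        push_cast
        rw [div_sub_div _ _ hs0.ne' (by positivity), div_pow,
          div_le_div_iff₀ (by positivity) (by positivity)]
        nlinarith
      linarith
  rcases lt_or_ge m 2 with hm | hm
  · rw [Finset.Icc_eq_empty (by omega)]
    norm_num
  · have h0 : (0 : ℝ) ≤ 1 / m := by positivity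
    linarith [key m hm]

/-- At least a quarter of the pairs of positive integers up to `m` are coprime. -/
theorem sq_le_four_mul_card_coprime (m : ℕ) :
    m ^ 2 ≤ 4 * ((Finset.Ioc 0 m ×ˢ Finset.Ioc 0 m).filter fun x => x.1.Coprime x.2).card := by
  -- Union bound over the gcd `d ≥ 2`: at most `(m / d) ^ 2` pairs are divisible by `d`.
  have hsub : ((Finset.Ioc 0 m ×ˢ Finset.Ioc 0 m).filter fun x => ¬ x.1.Coprime x.2) ⊆
      (Finset.Icc 2 m).biUnion fun d =>
        ((Finset.Ioc 0 m).filter (d ∣ ·)) ×ˢ ((Finset.Ioc 0 m).filter (d ∣ ·)) := by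
    rintro ⟨a, b⟩ h
    simp only [Finset.mem_filter, Finset.mem_product, Finset.mem_Ioc, Finset.mem_biUnion,
      Finset.mem_Icc] at h ⊢
    obtain ⟨⟨⟨ha, ham⟩, hb, hbm⟩, hab⟩ := h
    have hpos := Nat.gcd_pos_of_pos_left b ha
    have hle := Nat.gcd_le_left b ha
    rw [Nat.Coprime] at hab
    exact ⟨a.gcd b, ⟨by omega, by omega⟩, ⟨⟨ha, ham⟩, Nat.gcd_dvd_left a b⟩,
      ⟨hb, hbm⟩, Nat.gcd_dvd_right a b⟩
  have hcard := (Finset.card_le_card hsub).trans Finset.card_biUnion_le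
  simp only [Finset.card_product, Nat.Ioc_filter_dvd_card_eq_div] at hcard
  have htot := Finset.card_filter_add_card_filter_not
    (s := Finset.Ioc 0 m ×ˢ Finset.Ioc 0 m) (fun x : ℕ × ℕ => x.1.Coprime x.2)
  simp only [Finset.card_product, Nat.card_Ioc, Nat.sub_zero] at htot
  have hsum : ((∑ d ∈ Finset.Icc 2 m, m / d * (m / d) : ℕ) : ℝ) ≤ 3 / 4 * (m : ℝ) ^ 2 := by
    push_cast
    calc ∑ d ∈ Finset.Icc 2 m, ((m / d : ℕ) : ℝ) * ((m / d : ℕ) : ℝ)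
        ≤ ∑ d ∈ Finset.Icc 2 m, (1 / (d : ℝ)) ^ 2 * (m : ℝ) ^ 2 := by
          refine Finset.sum_le_sum fun d _ => ?_
          have h : ((m / d : ℕ) : ℝ) ≤ m / d := Nat.cast_div_le
          calc _ ≤ (m / d : ℝ) * (m / d) := by gcongr
            _ = _ := by ring
      _ ≤ _ := by
          rw [← Finset.sum_mul]
          gcongr
          exact sum_one_div_sq_Icc_two_le m
  have h1 : ((∑ d ∈ Finset.Icc 2 m, m / d * (m / d) : ℕ) : ℝ) * 4 ≤ ((3 * m ^ 2 : ℕ) : ℝ) := by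
    push_cast at hsum ⊢
    linarith
  have h2 : (∑ d ∈ Finset.Icc 2 m, m / d * (m / d)) * 4 ≤ 3 * m ^ 2 := by exact_mod_cast h1
  nlinarith

/-- The coprime directions `(p, q)` with `r < p ≤ 8 r` and `0 < q ≤ 8 r`. -/
def coprimeDirections (r : ℕ) : Finset (ℕ × ℕ) :=
  (Finset.Ioc r (8 * r) ×ˢ Finset.Ioc 0 (8 * r)).filter fun x => x.1.Coprime x.2

/-- Of the at least `16 * r ^ 2` coprime pairs up to `8 * r`, at most `8 * r ^ 2` are lost to the
condition `r < p`. -/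
theorem le_card_coprimeDirections (r : ℕ) : 8 * r ^ 2 ≤ (coprimeDirections r).card := by
  have h := sq_le_four_mul_card_coprime (8 * r)
  have hsub : ((Finset.Ioc 0 (8 * r) ×ˢ Finset.Ioc 0 (8 * r)).filter fun x => x.1.Coprime x.2) ⊆
      coprimeDirections r ∪ Finset.Ioc 0 r ×ˢ Finset.Ioc 0 (8 * r) := by
    rintro ⟨a, b⟩ h
    simp only [coprimeDirections, Finset.mem_filter, Finset.mem_product, Finset.mem_Ioc,
      Finset.mem_union] at h ⊢
    rcases le_or_gt a r with h' | h'
    · exact Or.inr ⟨⟨h.1.1.1, h'⟩, h.1.2⟩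
    · exact Or.inl ⟨⟨⟨h', h.1.1.2⟩, h.1.2⟩, h.2⟩
  have hcard := (Finset.card_le_card hsub).trans (Finset.card_union_le _ _)
  simp only [Finset.card_product, Nat.card_Ioc, Nat.sub_zero] at hcard
  nlinarith

theorem eq_of_coprime_of_mul_eq {p q p' q' : ℕ} (h : p.Coprime q) (h' : p'.Coprime q')
    (heq : p * q' = p' * q) : p = p' ∧ q = q' := by
  have h1 : p = p' := Nat.dvd_antisymm (h.dvd_of_dvd_mul_right ⟨q', heq.symm⟩)
    (h'.dvd_of_dvd_mul_right ⟨q, heq⟩)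
  have h2 : q = q' := Nat.dvd_antisymm
    (h.symm.dvd_of_dvd_mul_left ⟨p', by rw [heq, mul_comm]⟩)
    (h'.symm.dvd_of_dvd_mul_left ⟨p, by rw [← heq, mul_comm]⟩)
  exact ⟨h1, h2⟩

/-! ### Perturbed heights -/

/-- A perturbation of the multiples of `(2 * k + 1) ^ k` with no three of the points `(i, height k j)`
collinear on an oblique line, for `i, j < k`. -/
def height (k j : ℕ) : ℤ := (2 * k + 1 : ℤ) ^ k * j + (2 * k + 1 : ℤ) ^ j

theorem height_strictMono (k : ℕ) : StrictMono (height k) := by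
  intro a b hab
  have h1 : (2 * k + 1 : ℤ) ^ a ≤ (2 * k + 1 : ℤ) ^ b := pow_le_pow_right₀ (by omega) hab.le
  have h2 : (2 * k + 1 : ℤ) ^ k * a < (2 * k + 1 : ℤ) ^ k * b :=
    mul_lt_mul_of_pos_left (by exact_mod_cast hab) (by positivity)
  unfold height
  linarith

/-- The error of the approximation of `height k b - height k a` by `(2 * k + 1) ^ k * (b - a)`. -/
theorem abs_height_sub_sub_le {k a b : ℕ} (ha : a < k) (hb : b < k) :
    |height k b - height k a - (2 * k + 1 : ℤ) ^ k * ((b : ℤ) - a)| ≤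
      (2 * k + 1 : ℤ) ^ (k - 1) := by
  have e : height k b - height k a - (2 * k + 1 : ℤ) ^ k * ((b : ℤ) - a) =
      (2 * k + 1 : ℤ) ^ b - (2 * k + 1 : ℤ) ^ a := by unfold height; ring
  have h1 : (2 * k + 1 : ℤ) ^ a ≤ (2 * k + 1 : ℤ) ^ (k - 1) :=
    pow_le_pow_right₀ (by omega) (by omega)
  have h2 : (2 * k + 1 : ℤ) ^ b ≤ (2 * k + 1 : ℤ) ^ (k - 1) :=
    pow_le_pow_right₀ (by omega) (by omega)
  have h3 : 0 < (2 * k + 1 : ℤ) ^ a := by positivity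
  have h4 : 0 < (2 * k + 1 : ℤ) ^ b := by positivity
  rw [e, abs_le]
  constructor <;> linarith

/-- Modulo `(2 * k + 1) ^ (a + 1)` only `x * (2 * k + 1) ^ a` survives, since `a` is the least
index; it is nonzero because `|x| < 2 * k + 1`. -/
theorem height_combination_ne_zero_of_lt {k a b c : ℕ} {x y z : ℤ} (hx : x ≠ 0) (hxk : |x| < 2 * k)
    (ha : a < k) (hab : a < b) (hac : a < c) :
    x * height k a + y * height k b + z * height k c ≠ 0 := by
  intro h
  have hM : (0 : ℤ) < 2 * k + 1 := by positivity
  have hk : (2 * k + 1 : ℤ) ^ (a + 1) ∣ (2 * k + 1 : ℤ) ^ k := pow_dvd_pow _ ha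
  have hb : (2 * k + 1 : ℤ) ^ (a + 1) ∣ height k b :=
    dvd_add (hk.mul_right _) (pow_dvd_pow _ hab)
  have hc : (2 * k + 1 : ℤ) ^ (a + 1) ∣ height k c :=
    dvd_add (hk.mul_right _) (pow_dvd_pow _ hac)
  have h1 : (2 * k + 1 : ℤ) ^ (a + 1) ∣ x * (2 * k + 1 : ℤ) ^ a := by
    have e : x * (2 * k + 1 : ℤ) ^ a = -(x * ((2 * k + 1 : ℤ) ^ k * a)) -
        y * height k b - z * height k c := by
      have : height k a = (2 * k + 1 : ℤ) ^ k * a + (2 * k + 1 : ℤ) ^ a := rfl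
      rw [this] at h
      linarith
    rw [e]
    exact dvd_sub (dvd_sub ((hk.mul_right _).mul_left _).neg_right (hb.mul_left _)) (hc.mul_left _)
  rw [pow_succ, mul_comm x] at h1
  have h2 : (2 * k + 1 : ℤ) ∣ x := (mul_dvd_mul_iff_left (by positivity)).1 h1
  have h3 := Int.le_of_dvd (abs_pos.2 hx) ((dvd_abs _ _).2 h2)
  linarith

theorem height_combination_ne_zero {k a b c : ℕ} {x y z : ℤ} (hx : x ≠ 0) (hy : y ≠ 0) (hz : z ≠ 0)
    (hxk : |x| < 2 * k) (hyk : |y| < 2 * k) (hzk : |z| < 2 * k)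
    (ha : a < k) (hb : b < k) (hc : c < k) (hab : a ≠ b) (hbc : b ≠ c) (hac : a ≠ c) :
    x * height k a + y * height k b + z * height k c ≠ 0 := by
  intro h
  by_cases h1 : a < b ∧ a < c
  · exact height_combination_ne_zero_of_lt hx hxk ha h1.1 h1.2 h
  by_cases h2 : b < a ∧ b < c
  · exact height_combination_ne_zero_of_lt (y := x) (z := z) hy hyk hb h2.1 h2.2 (by linarith)
  · exact height_combination_ne_zero_of_lt (a := c) (b := a) (c := b) (y := x) (z := y) hz hzk hc
      (by omega) (by omega) (by linarith)

/-- The collinearity determinant is a combination of the three heights whose coefficients are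
differences of the first coordinates, hence nonzero and small. -/
theorem not_height_collinear {k i₁ i₂ i₃ a b c : ℕ} (hi₁ : i₁ < k) (hi₂ : i₂ < k) (hi₃ : i₃ < k)
    (h12 : i₁ ≠ i₂) (h13 : i₁ ≠ i₃) (h23 : i₂ ≠ i₃)
    (ha : a < k) (hb : b < k) (hc : c < k) (hab : a ≠ b) (hbc : b ≠ c) (hac : a ≠ c) :
    ((i₁ : ℤ) - i₂) * (height k a - height k c) ≠ (i₁ - i₃) * (height k a - height k b) := by
  intro h
  refine height_combination_ne_zero (x := i₃ - i₂) (y := i₁ - i₃) (z := i₂ - i₁)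
    (by omega) (by omega) (by omega) ?_ ?_ ?_ ha hb hc hab hbc hac (by linarith)
  all_goals rw [abs_lt]; constructor <;> omega

/-! ### The drawing and its crossings -/

/-- The complete bipartite graph between the vertices below `k` and those in `[k, 2 * k)`. -/
def weavingGraph (k n : ℕ) : SimpleGraph (Fin n) where
  Adj u v := (u.1 < k ∧ k ≤ v.1 ∧ v.1 < 2 * k) ∨ (v.1 < k ∧ k ≤ u.1 ∧ u.1 < 2 * k)
  symm := ⟨fun _ _ h => h.symm⟩
  loopless := ⟨fun v h => by omega⟩

/-- The positions of the vertices of `weavingGraph k n`: the two sides on two horizontal lines, the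
isolated vertices on a third one. -/
noncomputable def weavingPos (k n : ℕ) (v : Fin n) : ℝ × ℝ :=
  if v.1 < k then (v.1, 0) else if v.1 < 2 * k then (-(height k (v.1 - k) : ℝ), 1) else (v.1, 2)

theorem weavingPos_injective (k n : ℕ) : Function.Injective (weavingPos k n) := by
  intro u v h
  unfold weavingPos at h
  split_ifs at h with h1 h2 h3 h4 h5 h6 h7 h8 <;> simp only [Prod.mk.injEq] at h <;>
    obtain ⟨ha, hb⟩ := h
  all_goals first
    | (exact Fin.ext (by exact_mod_cast ha))
    | (exfalso; norm_num at hb; done)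
    | (have := (height_strictMono k).injective (by exact_mod_cast neg_injective ha)
       exact Fin.ext (by omega))

theorem mem_openSegment_of_levels (a b : ℝ) (p : ℝ × ℝ) :
    p ∈ openSegment ℝ (a, (0 : ℝ)) (-b, 1) ↔
      0 < p.2 ∧ p.2 < 1 ∧ p.1 = (1 - p.2) * a - p.2 * b := by
  constructor
  · rintro ⟨s, t, hs, ht, hst, rfl⟩
    simp only [Prod.smul_mk, smul_eq_mul, Prod.mk_add_mk]
    obtain rfl : s = 1 - t := by linarith
    refine ⟨by linarith, by linarith, by ring⟩
  · rintro ⟨h0, h1, h⟩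
    refine ⟨1 - p.2, p.2, by linarith, h0, by ring, ?_⟩
    ext
    · simp [h]; ring
    · simp

variable {k n : ℕ}

/-- The edge of `weavingGraph k n` between the `i`-th vertex of the first side and the `j`-th vertex
of the second side. -/
def weavingEdge (h : 2 * k ≤ n) (x : Fin k × Fin k) : (weavingGraph k n).edgeSet :=
  ⟨s(⟨x.1, by omega⟩, ⟨k + x.2, by omega⟩), by
    simp only [SimpleGraph.mem_edgeSet, weavingGraph]; omega⟩

theorem weavingEdge_injective (h : 2 * k ≤ n) : Function.Injective (weavingEdge h) := by
  rintro ⟨a, b⟩ ⟨c, d⟩ hxy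
  simp only [weavingEdge, Subtype.mk.injEq, Sym2.eq_iff, Fin.mk.injEq] at hxy
  ext <;> simp only <;> omega

theorem weavingEdge_surjective (h : 2 * k ≤ n) : Function.Surjective (weavingEdge h) := by
  rintro ⟨e, he⟩
  induction e with | _ u v => ?_
  simp only [SimpleGraph.mem_edgeSet, weavingGraph] at he
  rcases he with he | he
  · refine ⟨(⟨u, he.1⟩, ⟨v - k, by omega⟩), Subtype.ext (Sym2.eq_iff.2 (Or.inl ⟨rfl, Fin.ext ?_⟩))⟩
    exact Nat.add_sub_of_le he.2.1
  · refine ⟨(⟨v, he.1⟩, ⟨u - k, by omega⟩), Subtype.ext (Sym2.eq_iff.2 (Or.inr ⟨rfl, Fin.ext ?_⟩))⟩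
    exact Nat.add_sub_of_le he.2.1

/-- The points of the drawn edge between the `i`-th and the `j`-th vertex of the two sides. -/
def weavingLine (k : ℕ) (x : Fin k × Fin k) (p : ℝ × ℝ) : Prop :=
  0 < p.2 ∧ p.2 < 1 ∧ p.1 = (1 - p.2) * (x.1 : ℕ) - p.2 * height k x.2

theorem exists_mem_openSegment_weavingEdge_iff (h : 2 * k ≤ n) (x : Fin k × Fin k) (p : ℝ × ℝ) :
    (∃ u v, (weavingEdge h x : Sym2 (Fin n)) = s(u, v) ∧
      p ∈ openSegment ℝ (weavingPos k n u) (weavingPos k n v)) ↔ weavingLine k x p := by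
  rw [weavingLine, ← mem_openSegment_of_levels]
  have hu : weavingPos k n ⟨x.1, by omega⟩ = (((x.1 : ℕ) : ℝ), 0) := by simp [weavingPos]
  have hv : weavingPos k n ⟨k + x.2, by omega⟩ = (-(height k x.2 : ℝ), 1) := by
    simp [weavingPos]; omega
  constructor
  · rintro ⟨u, v, huv, hp⟩
    simp only [weavingEdge, Sym2.eq_iff] at huv
    rcases huv with ⟨rfl, rfl⟩ | ⟨rfl, rfl⟩
    · rwa [hu, hv] at hp
    · rwa [hu, hv, openSegment_symm] at hp
  · intro hp
    exact ⟨_, _, rfl, by rwa [hu, hv]⟩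

theorem weavingLine.sub_eq {x y : Fin k × Fin k} {p : ℝ × ℝ} (hx : weavingLine k x p)
    (hy : weavingLine k y p) :
    (1 - p.2) * ((y.1 : ℕ) - (x.1 : ℕ) : ℝ) = p.2 * (height k y.2 - height k x.2) := by
  have := hx.2.2
  have := hy.2.2
  linarith

theorem weavingLine.fst_ne_and_snd_ne {x y : Fin k × Fin k} {p : ℝ × ℝ} (hxy : x ≠ y)
    (hx : weavingLine k x p) (hy : weavingLine k y p) :
    (x.1 : ℕ) ≠ y.1 ∧ (x.2 : ℕ) ≠ y.2 := by
  have h := hx.sub_eq hy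
  have h0 := hx.1
  have h1 := hx.2.1
  constructor
  · intro e
    rw [e, sub_self, mul_zero, eq_comm, mul_eq_zero, or_iff_right h0.ne', sub_eq_zero] at h
    have := (height_strictMono k).injective (by exact_mod_cast h)
    exact hxy (Prod.ext (Fin.ext e) (Fin.ext this.symm))
  · intro e
    rw [e, sub_self, mul_zero, mul_eq_zero, or_iff_right (by linarith), sub_eq_zero] at h
    have : (y.1 : ℕ) = x.1 := by exact_mod_cast h
    exact hxy (Prod.ext (Fin.ext this.symm) (Fin.ext e))

/-- Concurrent edges have collinear points `(i, height k j)`: all their differences have the slope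
`(1 - p.2) / p.2`. -/
theorem weavingLine.not_three {x y z : Fin k × Fin k} {p : ℝ × ℝ} (hxy : x ≠ y) (hyz : y ≠ z)
    (hxz : x ≠ z) (hx : weavingLine k x p) (hy : weavingLine k y p) (hz : weavingLine k z p) :
    False := by
  have n1 := hx.fst_ne_and_snd_ne hxy hy
  have n2 := hy.fst_ne_and_snd_ne hyz hz
  have n3 := hx.fst_ne_and_snd_ne hxz hz
  have e1 := hx.sub_eq hy
  have e2 := hx.sub_eq hz
  have h0 := hx.1
  have h1 := hx.2.1
  refine not_height_collinear x.1.2 y.1.2 z.1.2 n1.1 n3.1 n2.1 x.2.2 y.2.2 z.2.2 n1.2 n2.2 n3.2 ?_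
  have key : (p.2 * (1 - p.2)) * (((x.1 : ℕ) - (y.1 : ℕ)) * (height k x.2 - height k z.2) : ℝ) =
      (p.2 * (1 - p.2)) * (((x.1 : ℕ) - (z.1 : ℕ)) * (height k x.2 - height k y.2)) := by
    linear_combination (-p.2) * (height k x.2 - height k z.2) * e1 +
      p.2 * (height k x.2 - height k y.2) * e2
  have := mul_left_cancel₀ (mul_pos h0 (by linarith)).ne' key
  exact_mod_cast this

/-- The drawing of `weavingGraph k n` at the positions `weavingPos k n`. -/
noncomputable def weavingDrawing (h : 2 * k ≤ n) : StraightLineDrawing (weavingGraph k n) where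
  pos := weavingPos k n
  pos_injective := weavingPos_injective k n
  vertex_not_on_edge := by
    have key : ∀ u v w : Fin n, u.1 < k → k ≤ v.1 → v.1 < 2 * k → w ≠ u → w ≠ v →
        weavingPos k n w ∉ segment ℝ (weavingPos k n u) (weavingPos k n v) := by
      intro u v w hu hv hv' hwu hwv hmem
      rw [← insert_endpoints_openSegment, Set.mem_insert_iff, Set.mem_insert_iff] at hmem
      rcases hmem with hmem | hmem | hmem
      · exact hwu (weavingPos_injective k n hmem)
      · exact hwv (weavingPos_injective k n hmem)
      · have eu : weavingPos k n u = (((u : ℕ) : ℝ), 0) := by simp [weavingPos, hu]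
        have ev : weavingPos k n v = (-(height k (v - k) : ℝ), 1) := by
          simp [weavingPos, hv', hv]
        rw [eu, ev, mem_openSegment_of_levels] at hmem
        obtain ⟨h1, h2, -⟩ := hmem
        unfold weavingPos at h1 h2
        split_ifs at h1 h2
        · exact lt_irrefl _ h1
        · exact lt_irrefl _ h2
        · norm_num at h2
    rintro u v w (huv | huv) hwu hwv
    · exact key u v w huv.1 huv.2.1 huv.2.2 hwu hwv
    · rw [segment_symm]
      exact key v u w huv.1 huv.2.1 huv.2.2 hwv hwu
  no_triple_crossing := by
    intro e f g p hef hfg heg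
    obtain ⟨x, rfl⟩ := weavingEdge_surjective h e
    obtain ⟨y, rfl⟩ := weavingEdge_surjective h f
    obtain ⟨z, rfl⟩ := weavingEdge_surjective h g
    simp only [exists_mem_openSegment_weavingEdge_iff]
    rintro ⟨hx, hy, hz⟩
    exact hx.not_three (ne_of_apply_ne _ hef) (ne_of_apply_ne _ hfg) (ne_of_apply_ne _ heg) hy hz

theorem weavingDrawing_crossAt_iff (h : 2 * k ≤ n) (x y : Fin k × Fin k) (p : ℝ × ℝ) :
    (weavingDrawing h).CrossAt (weavingEdge h x) (weavingEdge h y) p ↔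
      x ≠ y ∧ weavingLine k x p ∧ weavingLine k y p := by
  rw [StraightLineDrawing.CrossAt, (weavingEdge_injective h).ne_iff]
  exact and_congr_right fun _ => and_congr (exists_mem_openSegment_weavingEdge_iff h x p)
    (exists_mem_openSegment_weavingEdge_iff h y p)

theorem exists_weavingLine_weavingLine {x y : Fin k × Fin k} (h1 : (x.1 : ℕ) < y.1)
    (h2 : (x.2 : ℕ) < y.2) : ∃ p, weavingLine k x p ∧ weavingLine k y p := by
  have e1 : (0 : ℝ) < (y.1 : ℕ) - (x.1 : ℕ) := sub_pos.2 (by exact_mod_cast h1)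
  have e2 : (0 : ℝ) < height k y.2 - height k x.2 :=
    sub_pos.2 (by exact_mod_cast height_strictMono k h2)
  set u : ℝ := (y.1 : ℕ) - (x.1 : ℕ) with hu
  set v : ℝ := height k y.2 - height k x.2 with hv
  -- The crossing level `t = u / (u + v)` solves `(1 - t) * u = t * v`.
  have h0 : 0 < u / (u + v) := by positivity
  have h1 : u / (u + v) < 1 := by rw [div_lt_one (by positivity)]; linarith
  have h3 : (1 - u / (u + v)) * u = u / (u + v) * v := by field_simp; ring
  refine ⟨((1 - u / (u + v)) * (x.1 : ℕ) - u / (u + v) * height k x.2, u / (u + v)),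
    ⟨h0, h1, rfl⟩, h0, h1, ?_⟩
  dsimp only
  rw [show ((y.1 : ℕ) : ℝ) = u + (x.1 : ℕ) by rw [hu]; ring,
    show (height k y.2 : ℝ) = v + height k x.2 by rw [hv]; ring]
  linear_combination -h3

theorem weavingDrawing_crossAt_unique (h : 2 * k ≤ n) {e f : (weavingGraph k n).edgeSet}
    {p q : ℝ × ℝ} (hp : (weavingDrawing h).CrossAt e f p) (hq : (weavingDrawing h).CrossAt e f q) :
    p = q := by
  obtain ⟨x, rfl⟩ := weavingEdge_surjective h e
  obtain ⟨y, rfl⟩ := weavingEdge_surjective h f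
  rw [weavingDrawing_crossAt_iff] at hp hq
  obtain ⟨hxy, hpx, hpy⟩ := hp
  obtain ⟨-, hqx, hqy⟩ := hq
  have e1 := hpx.sub_eq hpy
  have e2 := hqx.sub_eq hqy
  have hne : ((y.1 : ℕ) - (x.1 : ℕ) : ℝ) ≠ 0 :=
    sub_ne_zero.2 (by exact_mod_cast (hpx.fst_ne_and_snd_ne hxy hpy).1.symm)
  have h2 : p.2 = q.2 := by
    have : (p.2 - q.2) * (((y.1 : ℕ) - (x.1 : ℕ) : ℝ) + (height k y.2 - height k x.2)) = 0 := by
      linear_combination e2 - e1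
    rcases mul_eq_zero.1 this with h | h
    · linarith
    · exact absurd (by linear_combination e1 + p.2 * h) hne
  exact Prod.ext (by rw [hpx.2.2, hqx.2.2, h2]) h2

/-! ### Crossings close to a grid direction -/

/-- The point `p` is a possible crossing of edges whose index pairs differ by a multiple of
`(a, b)`. -/
def NearDirection (k a b : ℕ) (p : ℝ × ℝ) : Prop :=
  |(1 - p.2) * a - p.2 * ((2 * k + 1 : ℝ) ^ k * b)| ≤ p.2 * (2 * k + 1 : ℝ) ^ (k - 1)

/-- The condition is a pair of linear inequalities in `p.2`, hence convex. This carries it from two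
crossings of a triple to the switch between them. -/
theorem NearDirection.of_mem_segment {a b : ℕ} {p q r : ℝ × ℝ} (hp : NearDirection k a b p)
    (hq : NearDirection k a b q) (hr : r ∈ segment ℝ p q) : NearDirection k a b r := by
  obtain ⟨s, t, hs, ht, hst, rfl⟩ := hr
  unfold NearDirection at *
  simp only [Prod.snd_add, Prod.smul_snd, smul_eq_mul]
  obtain rfl : s = 1 - t := by linarith
  rw [abs_le] at *
  have h1 := mul_le_mul_of_nonneg_left hp.1 hs
  have h2 := mul_le_mul_of_nonneg_left hp.2 hs
  have h3 := mul_le_mul_of_nonneg_left hq.1 ht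
  have h4 := mul_le_mul_of_nonneg_left hq.2 ht
  constructor <;> linarith

theorem abs_height_sub_sub_le_real {a b : ℕ} (ha : a < k) (hb : b < k) :
    |(height k b - height k a : ℝ) - (2 * k + 1 : ℝ) ^ k * ((b : ℝ) - a)| ≤
      (2 * k + 1 : ℝ) ^ (k - 1) := by
  exact_mod_cast abs_height_sub_sub_le ha hb

/-- The height error is bounded independently of `m`, so dividing by `|m| ≥ 1` only improves the
estimate. -/
theorem weavingLine.nearDirection {a b : ℕ} {x y : Fin k × Fin k} {p : ℝ × ℝ} {m : ℤ} (hm : m ≠ 0)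
    (hx : weavingLine k x p) (hy : weavingLine k y p)
    (h1 : ((y.1 : ℕ) : ℤ) - (x.1 : ℕ) = m * a) (h2 : ((y.2 : ℕ) : ℤ) - (x.2 : ℕ) = m * b) :
    NearDirection k a b p := by
  have e := hx.sub_eq hy
  have hE := abs_height_sub_sub_le_real x.2.2 y.2.2
  have h1' : ((y.1 : ℕ) : ℝ) - (x.1 : ℕ) = m * a := by exact_mod_cast h1
  have h2' : ((y.2 : ℕ) : ℝ) - (x.2 : ℕ) = m * b := by exact_mod_cast h2
  rw [h1'] at e
  rw [h2'] at hE
  have hm1 : (1 : ℝ) ≤ |(m : ℝ)| := by exact_mod_cast Int.one_le_abs hm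
  have hE' := mul_le_mul_of_nonneg_left hE hx.1.le
  rw [← abs_of_pos hx.1, ← abs_mul, abs_of_pos hx.1] at hE'
  unfold NearDirection
  refine (le_mul_of_one_le_left (abs_nonneg _) hm1).trans ?_
  rw [← abs_mul]
  convert hE' using 2
  linear_combination e

/-- The determinant of the index difference and `(a, b)` is an integer. The direction error and the
height error, each weighted by at most `k`, bound it by `2 * k / (2 * k + 1) < 1`, so it vanishes.
-/
theorem weavingLine.collinear_of_nearDirection {a b : ℕ} {x y : Fin k × Fin k} {p : ℝ × ℝ}
    (ha : a < k) (hp : NearDirection k a b p) (hx : weavingLine k x p) (hy : weavingLine k y p) :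
    (((y.2 : ℕ) : ℤ) - (x.2 : ℕ)) * a = (((y.1 : ℕ) : ℤ) - (x.1 : ℕ)) * b := by
  have e := hx.sub_eq hy
  have hE := abs_height_sub_sub_le_real x.2.2 y.2.2
  have h0 := hx.1
  set E : ℝ := (2 * k + 1 : ℝ) ^ (k - 1) with hEdef
  have hE0 : 0 < E := by positivity
  have hL : (2 * k + 1 : ℝ) ^ k = (2 * k + 1) * E := by
    rw [hEdef, ← pow_succ']
    congr 1
    omega
  unfold NearDirection at hp
  rw [hL] at hE hp
  rw [← hEdef] at hp
  have hi : |((y.1 : ℕ) : ℝ) - (x.1 : ℕ)| ≤ k := by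
    have h1 : ((y.1 : ℕ) : ℝ) ≤ k := by exact_mod_cast y.1.2.le
    have h2 : ((x.1 : ℕ) : ℝ) ≤ k := by exact_mod_cast x.1.2.le
    have h3 : (0 : ℝ) ≤ (y.1 : ℕ) := by positivity
    have h4 : (0 : ℝ) ≤ (x.1 : ℕ) := by positivity
    rw [abs_le]
    constructor <;> linarith
  have hak : (a : ℝ) ≤ k := by exact_mod_cast ha.le
  set u : ℝ := ((y.1 : ℕ) : ℝ) - (x.1 : ℕ)
  set v : ℝ := ((y.2 : ℕ) : ℝ) - (x.2 : ℕ)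
  set w : ℝ := height k y.2 - height k x.2
  have b1 : |u * ((1 - p.2) * a - p.2 * ((2 * k + 1) * E * b))| ≤ k * (p.2 * E) := by
    rw [abs_mul]
    gcongr
  have b2 : |p.2 * a * (w - (2 * k + 1) * E * v)| ≤ p.2 * k * E := by
    rw [abs_mul, abs_of_nonneg (by positivity)]
    gcongr
  have b3 : p.2 * E * ((2 * k + 1) * |v * a - u * b|) ≤ p.2 * E * (2 * k) := by
    have id : p.2 * E * (2 * k + 1) * (v * a - u * b) =
        u * ((1 - p.2) * a - p.2 * ((2 * k + 1) * E * b)) -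
          p.2 * a * (w - (2 * k + 1) * E * v) := by
      linear_combination -a * e
    have habs : p.2 * E * ((2 * k + 1) * |v * a - u * b|) =
        |p.2 * E * (2 * k + 1) * (v * a - u * b)| := by
      rw [abs_mul, abs_of_pos (a := p.2 * E * (2 * k + 1)) (by positivity)]
      ring
    rw [habs, id]
    refine (abs_sub _ _).trans ?_
    linarith
  have b4 := le_of_mul_le_mul_left b3 (by positivity)
  have b5 : |v * a - u * b| < 1 := by
    by_contra hcon
    have : (2 * k + 1 : ℝ) * 1 ≤ (2 * k + 1) * |v * a - u * b| := by
      gcongr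
      exact not_lt.1 hcon
    linarith
  have b6 : |(((y.2 : ℕ) : ℤ) - (x.2 : ℕ)) * a - (((y.1 : ℕ) : ℤ) - (x.1 : ℕ)) * b| < 1 := by
    rw [← Int.cast_lt (R := ℝ)]
    push_cast
    exact b5
  exact sub_eq_zero.1 (Int.abs_lt_one_iff.1 b6)

/-! ### Counting switches -/

/-- The three grid points `P`, `P + (a, b)` and `P + 2 (a, b)`. -/
def gridTriple {P : ℕ × ℕ} {a b : ℕ} (h1 : P.1 + 2 * a < k) (h2 : P.2 + 2 * b < k) (m : Fin 3) :
    Fin k × Fin k :=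
  (⟨P.1 + m * a, by nlinarith [m.2]⟩, ⟨P.2 + m * b, by nlinarith [m.2]⟩)

/-- Each grid line through three grid points carries both edges of the first pair of some switch. -/
theorem exists_switch_on_line (h : 2 * k ≤ n) (κ : (weavingDrawing h).Casing) {P : ℕ × ℕ} {a b : ℕ}
    (ha : 0 < a) (hb : 0 < b) (h1 : P.1 + 2 * a < k) (h2 : P.2 + 2 * b < k) :
    ∃ (m : Fin 3) (z : Fin k × Fin k) (g : (weavingGraph k n).edgeSet),
      (weavingEdge h (gridTriple h1 h2 m), weavingEdge h z, g) ∈ κ.switches ∧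
      gridTriple h1 h2 m ≠ z ∧
      (((z.2 : ℕ) : ℤ) - (P.2 + m * b : ℕ)) * a = (((z.1 : ℕ) : ℤ) - (P.1 + m * a : ℕ)) * b := by
  have cross_lt : ∀ i j : Fin 3, i < j → ∃ p, (weavingDrawing h).CrossAt
      (weavingEdge h (gridTriple h1 h2 i)) (weavingEdge h (gridTriple h1 h2 j)) p := by
    intro i j hij
    have l1 : ((gridTriple h1 h2 i).1 : ℕ) < (gridTriple h1 h2 j).1 := by
      simp only [gridTriple]; gcongr; exact hij
    have l2 : ((gridTriple h1 h2 i).2 : ℕ) < (gridTriple h1 h2 j).2 := by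
      simp only [gridTriple]; gcongr; exact hij
    obtain ⟨p, hp⟩ := exists_weavingLine_weavingLine l1 l2
    exact ⟨p, (weavingDrawing_crossAt_iff h _ _ p).2 ⟨fun e => by rw [e] at l1; omega, hp⟩⟩
  have cross : ∀ i j : Fin 3, i ≠ j → (weavingDrawing h).Cross
      (weavingEdge h (gridTriple h1 h2 i)) (weavingEdge h (gridTriple h1 h2 j)) := by
    intro i j hij
    rcases lt_or_gt_of_ne hij with hlt | hlt
    · exact cross_lt i j hlt
    · obtain ⟨p, hp⟩ := cross_lt j i hlt
      exact ⟨p, hp.1.symm, hp.2.2, hp.2.1⟩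
  have near : ∀ i j : Fin 3, i ≠ j → ∀ p, (weavingDrawing h).CrossAt
      (weavingEdge h (gridTriple h1 h2 i)) (weavingEdge h (gridTriple h1 h2 j)) p →
      NearDirection k a b p := by
    intro i j hij p hp
    obtain ⟨-, hx, hy⟩ := (weavingDrawing_crossAt_iff h _ _ p).1 hp
    refine hx.nearDirection (m := (j : ℕ) - (i : ℕ)) ?_ hy ?_ ?_
    · rw [sub_ne_zero]
      exact fun e => hij (Fin.ext (by omega))
    · simp only [gridTriple]; push_cast; ring
    · simp only [gridTriple]; push_cast; ring
  obtain ⟨i, j, l, hij, hil, hj, hl⟩ :=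
    κ.exists_onTop_onTop (fun m => weavingEdge h (gridTriple h1 h2 m)) cross
  obtain ⟨p, hp⟩ := cross i j hij
  obtain ⟨q, hq⟩ := cross i l hil
  obtain ⟨f, g, r, hs, hf, hr⟩ := κ.exists_switch_between
    (fun _ _ _ => weavingDrawing_crossAt_unique h) hp hq hj hl
  obtain ⟨z, rfl⟩ := weavingEdge_surjective h f
  obtain ⟨hne, hx, hz⟩ := (weavingDrawing_crossAt_iff h _ _ r).1 hf
  exact ⟨i, z, g, hs, hne, hx.collinear_of_nearDirection (by omega)
    ((near i j hij p hp).of_mem_segment (near i l hil q hq) hr) hz⟩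

/-- The grid side `24 * r` leaves room for a base coordinate below `8 * r` and two steps of at most
`8 * r`. -/
theorem le_ncard_switches {r n : ℕ} (h : 2 * (24 * r) ≤ n)
    (κ : (weavingDrawing h).Casing) : 64 * r ^ 4 ≤ κ.switches.ncard := by
  let T : Finset ((ℕ × ℕ) × (ℕ × ℕ)) :=
    coprimeDirections r ×ˢ (Finset.range r ×ˢ Finset.range (8 * r))
  have hT : 64 * r ^ 4 ≤ T.card := by
    have := le_card_coprimeDirections r
    simp only [T, Finset.card_product, Finset.card_range]
    calc 64 * r ^ 4 = (8 * r ^ 2) * (r * (8 * r)) := by ring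
      _ ≤ _ := by gcongr
  have hmem : ∀ t ∈ T, (r < t.1.1 ∧ t.1.1 ≤ 8 * r) ∧ (0 < t.1.2 ∧ t.1.2 ≤ 8 * r) ∧
      t.1.1.Coprime t.1.2 ∧ t.2.1 < r ∧ t.2.2 < 8 * r := by
    intro t ht
    simp only [T, coprimeDirections, Finset.mem_product, Finset.mem_filter, Finset.mem_Ioc,
      Finset.mem_range] at ht
    tauto
  have hex : ∀ t ∈ T, ∃ s ∈ κ.switches, ∃ (m : Fin 3) (x z : Fin (24 * r) × Fin (24 * r)),
      s.1 = weavingEdge h x ∧ s.2.1 = weavingEdge h z ∧ x ≠ z ∧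
      (x.1 : ℕ) = t.2.1 + m * t.1.1 ∧ (x.2 : ℕ) = t.2.2 + m * t.1.2 ∧
      (((z.2 : ℕ) : ℤ) - (x.2 : ℕ)) * t.1.1 = (((z.1 : ℕ) : ℤ) - (x.1 : ℕ)) * t.1.2 := by
    intro t ht
    obtain ⟨⟨a1, a2⟩, ⟨b1, b2⟩, -, c1, c2⟩ := hmem t ht
    obtain ⟨m, z, g, hs, hne, hcol⟩ := exists_switch_on_line h κ (P := t.2) (a := t.1.1)
      (b := t.1.2) (by omega) b1 (by omega) (by omega)
    exact ⟨_, hs, m, _, z, rfl, rfl, hne, rfl, rfl, hcol⟩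
  rcases T.eq_empty_or_nonempty with h0 | ⟨t₀, ht₀⟩
  · rw [h0, Finset.card_empty] at hT
    exact hT.trans (Nat.zero_le _)
  -- `choose!` needs an inhabited codomain for values outside `T`.
  have := Nonempty.intro (hex t₀ ht₀).choose
  choose! F hF using hex
  refine hT.trans ?_
  rw [← Set.ncard_coe_finset]
  refine Set.ncard_le_ncard_of_injOn F (fun t ht => (hF t ht).1) ?_ (Set.toFinite _)
  intro t ht t' ht' htt
  obtain ⟨-, m, x, z, hx, hz, hne, x1, x2, hcol⟩ := hF t ht
  obtain ⟨-, m', x', z', hx', hz', -, x1', x2', hcol'⟩ := hF t' ht'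
  rw [htt] at hx hz
  obtain rfl := weavingEdge_injective h (hx.symm.trans hx')
  obtain rfl := weavingEdge_injective h (hz.symm.trans hz')
  obtain ⟨⟨a1, a2⟩, ⟨b1, b2⟩, cop, c1, c2⟩ := hmem t ht
  obtain ⟨⟨a1', a2'⟩, ⟨b1', b2'⟩, cop', c1', c2'⟩ := hmem t' ht'
  have hd : ((z.1 : ℕ) : ℤ) - (x.1 : ℕ) ≠ 0 := by
    intro e
    rw [e, zero_mul, mul_eq_zero, or_iff_left (by omega)] at hcol
    exact hne (Prod.ext (Fin.ext (by omega)) (Fin.ext (by omega)))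
  -- Both directions are parallel to the nonzero vector `z - x`; being coprime, they agree.
  have hdir : (t.1.1 : ℤ) * t'.1.2 = t'.1.1 * t.1.2 := by
    refine mul_left_cancel₀ hd ?_
    linear_combination (t'.1.1 : ℤ) * hcol - t.1.1 * hcol'
  obtain ⟨e1, e2⟩ := eq_of_coprime_of_mul_eq cop cop' (by exact_mod_cast hdir)
  rw [← e1, x1] at x1'
  rw [← e2, x2] at x2'
  -- The first base coordinate is below `r < t.1.1`, so `m` is the quotient of `x.1` by `t.1.1`.
  have hm : m = m' := by
    have d1 : (t.2.1 + m * t.1.1) / t.1.1 = m := by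
      rw [Nat.add_mul_div_right _ _ (by omega), Nat.div_eq_of_lt (by omega), zero_add]
    have d2 : (t'.2.1 + m' * t.1.1) / t.1.1 = m' := by
      rw [Nat.add_mul_div_right _ _ (by omega), Nat.div_eq_of_lt (by omega), zero_add]
    rw [x1', d2] at d1
    exact Fin.ext d1.symm
  subst hm
  exact Prod.ext (Prod.ext e1 e2) (Prod.ext (by omega) (by omega))

theorem lemma5 :
    ∃ (c C : ℝ) (N : ℕ), 0 < c ∧ ∀ n : ℕ, N ≤ n →
      ∃ (G : SimpleGraph (Fin n)) (D : StraightLineDrawing G),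
        (G.edgeSet.ncard : ℝ) ≤ C * (n : ℝ) ^ 2 ∧
        ∀ κ : D.Casing, c * (n : ℝ) ^ 4 ≤ (κ.switches.ncard : ℝ) := by
  -- For `n ≥ 48`, rounding in `n / 48` loses at most a factor 2, whence `96`.
  refine ⟨64 / 96 ^ 4, 1, 48, by norm_num, fun n hn => ?_⟩
  have hk : 2 * (24 * (n / 48)) ≤ n := by omega
  refine ⟨weavingGraph (24 * (n / 48)) n, weavingDrawing hk, ?_, fun κ => ?_⟩
  · classical
    have h := (weavingGraph (24 * (n / 48)) n).card_edgeFinset_le_card_choose_two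
    rw [Fintype.card_fin] at h
    have h' := h.trans (Nat.choose_le_pow n 2)
    rw [one_mul, ← SimpleGraph.coe_edgeFinset, Set.ncard_coe_finset]
    exact_mod_cast h'
  · have h1 : ((64 * (n / 48) ^ 4 : ℕ) : ℝ) ≤ κ.switches.ncard := by
      exact_mod_cast le_ncard_switches hk κ
    have h2 : (n : ℝ) ≤ 96 * (n / 48 : ℕ) := by
      exact_mod_cast (show n ≤ 96 * (n / 48) by omega)
    have h3 : (n : ℝ) ^ 4 ≤ (96 * (n / 48 : ℕ)) ^ 4 := by gcongr
    refine le_trans ?_ h1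
    push_cast
    rw [mul_pow] at h3
    linarith
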